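/- Let $\mathbf K=\langle K,\le_{\mathbf K}\rangle$ be an abstract elementary class (AEC) in a finitary language $L$. A $\mathbf K$-embedding $f:M\to N$ is an isomorphism of $M$ onto some $N'\le_{\mathbf K}N$. Assume that $\mathbf K$ admits a monster model, i.e. that it has the amalgamation property, the joint embedding property and no maximal models, and that it has amalgamation over sets: if $M_1,M_2\in K$, $A\subseteq |M_1|\cap|M_2|$, and $M_1,M_2$ interpret $A$ in the same way (they satisfy the same quantifier-free $L$-formulas with parameters in $A$), then there are $N\in K$ and $\mathbf K$-embeddings $g_1:M_1\to N$, $g_2:M_2\to N$ with $g_1\restriction A=g_2\restriction A$. For $M\in K$, a set $A\subseteq|M|$ and $x\in|M|$, the Galois type $\mathrm{gtp}(x/A;M)$ is the class of $(x,A,M)$ under the equivalence relation generated by: $(x,A,M)\sim(y,A,N)$ if there are $\mathbf K$-embeddings $f:M\to N'$, $g:N\to N'$ into some $N'\in K$ with $f\restriction A=g\restriction A$ and $f(x)=g(y)$. Let $\mathrm{gS}(A;M)=\{\mathrm{gtp}(x/A;M):x\in|M|\}$. For an infinite cardinal $\lambda$, $\mathbf K$ is stable in $\lambda$ if $|\mathrm{gS}(A;M)|\le\lambda$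 for all $M\in K$ and all $A\subseteq|M|$ with $|A|\le\lambda$. $\mathbf K$ is $\mu$-tame if, whenever $M\in K$, $A\subseteq|M|$ and $p\ne q$ are in $\mathrm{gS}(A;M)$, there is $A_0\subseteq A$ with $|A_0|\le\mu$ and $p\restriction A_0\ne q\restriction A_0$. The sets $A$ need not be models, and the cardinals $\mu,\lambda$ may be smaller than the Löwenheim–Skolem number $\mathrm{LS}(\mathbf K)$. Theorem. Let $\mu$ be an infinite cardinal. If $\mathbf K$ is $\mu$-tame and stable in $\mu$, then $\mathbf K$ is stable in every infinite cardinal $\lambda$ with $\lambda^{\mu}=\lambda$. -/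

import Mathlib

open scoped FirstOrder Cardinal

universe u

/-- For substructures `S ≤ T` of an ambient structure, `S` seen as a substructure of `T`. -/
def FirstOrder.Language.Substructure.within {L : FirstOrder.Language.{u, u}} {N : Type u} [L.Structure N]
    (S T : L.Substructure N) : L.Substructure T :=
  S.comap T.subtype.toHom

/-- An abstract elementary class `K = ⟨K, ≤_K⟩` in the finitary language `L`.
`Mem M` says `M ∈ K`, and for a substructure `S` of `N`, `Strong S` says `S ≤_K N`. -/
structure AEC (L : FirstOrder.Language.{u, u}) where
  Mem : (M : Type u) → [L.Structure M] → Prop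
  Strong : {N : Type u} → [L.Structure N] → L.Substructure N → Prop
  /-- `≤_K` is a relation on `K`. -/
  mem_of_strong : ∀ {N : Type u} [L.Structure N] {S : L.Substructure N},
    Strong S → Mem S ∧ Mem N
  /-- `K` is closed under isomorphism. -/
  mem_equiv : ∀ {M N : Type u} [L.Structure M] [L.Structure N], (M ≃[L] N) → Mem M → Mem N
  /-- `≤_K` is invariant under isomorphism. -/
  strong_equiv : ∀ {M N : Type u} [L.Structure M] [L.Structure N] (e : M ≃[L] N)
    {S : L.Substructure M}, Strong S → Strong (S.map e.toHom)
  /-- Reflexivity of `≤_K`. -/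
  strong_top : ∀ {N : Type u} [L.Structure N], Mem N → Strong (⊤ : L.Substructure N)
  /-- Transitivity of `≤_K`. -/
  strong_trans : ∀ {N : Type u} [L.Structure N] {S T : L.Substructure N},
    S ≤ T → Strong (S.within T) → Strong T → Strong S
  /-- Coherence: if `S ⊆ T`, `S ≤_K N` and `T ≤_K N`, then `S ≤_K T`. -/
  coherence : ∀ {N : Type u} [L.Structure N] {S T : L.Substructure N},
    S ≤ T → Strong S → Strong T → Strong (S.within T)
  /-- Chains, first part: the union of a nonempty well-ordered `≤_K`-increasing chain lies in `K`
  and every member of the chain is `≤_K` the union. -/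
  chain_union : ∀ {N : Type u} [L.Structure N] {ι : Type u} [LinearOrder ι] [WellFoundedLT ι]
    [Nonempty ι] (S : ι → L.Substructure N), Monotone S →
    (∀ i j, i ≤ j → Strong ((S i).within (S j))) →
    ∀ i, Strong ((S i).within (⨆ j, S j))
  /-- Chains, second part (smoothness): if every member of the chain is `≤_K N`, then so is the
  union. -/
  chain_smooth : ∀ {N : Type u} [L.Structure N] {ι : Type u} [LinearOrder ι] [WellFoundedLT ι]
    [Nonempty ι] (S : ι → L.Substructure N), Monotone S →
    (∀ i j, i ≤ j → Strong ((S i).within (S j))) →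
    (∀ i, Strong (S i)) → Strong (⨆ j, S j)
  /-- The Löwenheim–Skolem–Tarski axiom. (The least such `κ` is `LS(K)`.) -/
  exists_LS : ∃ κ : Cardinal.{u}, ℵ₀ ≤ κ ∧ L.card ≤ κ ∧
    ∀ {N : Type u} [L.Structure N], Mem N → ∀ A : Set N,
      ∃ S : L.Substructure N, A ⊆ (S : Set N) ∧ Strong S ∧ #S ≤ #A + κ

namespace AEC

variable {L : FirstOrder.Language.{u, u}} (K : AEC L)

/-- `f : M → N` is a `K`-embedding: an isomorphism of `M` onto some `S ≤_K N`. -/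
def IsEmb {M N : Type u} [L.Structure M] [L.Structure N] (f : M ↪[L] N) : Prop :=
  K.Strong f.toHom.range

/-- The amalgamation property `AP`. -/
def AP : Prop :=
  ∀ (M₀ M₁ M₂ : Type u) [L.Structure M₀] [L.Structure M₁] [L.Structure M₂]
    (f₁ : M₀ ↪[L] M₁) (f₂ : M₀ ↪[L] M₂), K.IsEmb f₁ → K.IsEmb f₂ →
    ∃ (N : Type u) (_ : L.Structure N) (g₁ : M₁ ↪[L] N) (g₂ : M₂ ↪[L] N),
      K.IsEmb g₁ ∧ K.IsEmb g₂ ∧ ∀ x, g₁ (f₁ x) = g₂ (f₂ x)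

/-- The joint embedding property `JEP`. -/
def JEP : Prop :=
  ∀ (M₁ M₂ : Type u) [L.Structure M₁] [L.Structure M₂], K.Mem M₁ → K.Mem M₂ →
    ∃ (N : Type u) (_ : L.Structure N) (g₁ : M₁ ↪[L] N) (g₂ : M₂ ↪[L] N),
      K.IsEmb g₁ ∧ K.IsEmb g₂

/-- No maximal model, `NMM`. -/
def NMM : Prop :=
  ∀ (M : Type u) [L.Structure M], K.Mem M →
    ∃ (N : Type u) (_ : L.Structure N) (g : M ↪[L] N),
      K.IsEmb g ∧ ¬ Function.Surjective g

/-- The common subset `A` of `M₁` and `M₂` (given by its two inclusion maps) is interpreted in the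
same way by `M₁` and `M₂`: the same quantifier-free formulas with parameters in `A` hold. -/
def SameInterpretation {A M₁ M₂ : Type u} [L.Structure M₁] [L.Structure M₂]
    (i₁ : A ↪ M₁) (i₂ : A ↪ M₂) : Prop :=
  ∀ φ : L.Formula A, φ.IsQF → (φ.Realize i₁ ↔ φ.Realize i₂)

/-- Amalgamation over set bases. -/
def SetAP : Prop :=
  ∀ (A M₁ M₂ : Type u) [L.Structure M₁] [L.Structure M₂], K.Mem M₁ → K.Mem M₂ →
    ∀ (i₁ : A ↪ M₁) (i₂ : A ↪ M₂), SameInterpretation (L := L) i₁ i₂ →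
    ∃ (N : Type u) (_ : L.Structure N) (g₁ : M₁ ↪[L] N) (g₂ : M₂ ↪[L] N),
      K.IsEmb g₁ ∧ K.IsEmb g₂ ∧ ∀ a, g₁ (i₁ a) = g₂ (i₂ a)

/-- A triple `(x, A, M)` with `M ∈ K`, `A ⊆ |M|` and `x ∈ |M|`. -/
structure Triple (A : Type u) where
  carrier : Type u
  [str : L.Structure carrier]
  mem : K.Mem carrier
  base : A ↪ carrier
  pt : carrier

attribute [instance] Triple.str

/-- Atomic equivalence of `(x, A, M)` and `(y, A, N)`: some pair of `K`-embeddings of `M` and `N`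
into a common model agrees on `A` and identifies `x` with `y`. -/
def AtomicEquiv {A : Type u} (p q : K.Triple A) : Prop :=
  ∃ (N : Type u) (_ : L.Structure N) (f : p.carrier ↪[L] N) (g : q.carrier ↪[L] N),
    K.IsEmb f ∧ K.IsEmb g ∧ (∀ a, f (p.base a) = g (q.base a)) ∧ f p.pt = g q.pt

/-- Galois (orbital) types over `A`, of length one: classes of triples modulo the equivalence
relation generated by `AtomicEquiv`. -/
def GaloisType (A : Type u) : Type (u + 1) :=
  Quot (K.AtomicEquiv (A := A))

/-- The Galois type `gtp(x / A; M)`. -/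
def gtp {M : Type u} [L.Structure M] (hM : K.Mem M) (A : Set M) (x : M) : K.GaloisType A :=
  Quot.mk _ { carrier := M, mem := hM, base := Function.Embedding.subtype _, pt := x }

/-- `gS(A; M)`, the set of Galois types over `A` realized in `M`. -/
def gS {M : Type u} [L.Structure M] (hM : K.Mem M) (A : Set M) : Set (K.GaloisType A) :=
  Set.range (K.gtp hM A)

/-- `K` is stable in `κ`: `|gS(A; M)| ≤ κ` whenever `M ∈ K`, `A ⊆ |M|` and `|A| ≤ κ`. There is no
relation imposed between `κ` and `LS(K)`. -/
def StableIn (κ : Cardinal.{u}) : Prop :=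
  ∀ (M : Type u) [L.Structure M] (hM : K.Mem M) (A : Set M),
    #A ≤ κ → #(K.gS hM A) ≤ Cardinal.lift.{u + 1} κ

/-- `K` is `(<κ)`-tame: distinct Galois types over a set `A` are already distinct over some
subset of `A` of size `< κ`. -/
def TameBelow (κ : Cardinal.{u}) : Prop :=
  ∀ (M : Type u) [L.Structure M] (hM : K.Mem M) (A : Set M) (x y : M),
    K.gtp hM A x ≠ K.gtp hM A y →
      ∃ A₀ : Set M, A₀ ⊆ A ∧ #A₀ < κ ∧ K.gtp hM A₀ x ≠ K.gtp hM A₀ y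

/-- `μ`-tame means `(<μ⁺)`-tame. -/
def Tame (μ : Cardinal.{u}) : Prop :=
  K.TameBelow (Order.succ μ)

end AEC

/-! Amalgamation over sets makes Galois types syntactic: two points of a model with the same
quantifier-free type over `A` can be identified in an amalgam fixing `A`, and conversely embeddings
preserve quantifier-free formulas (`SetAP.gtp_eq_iff`). Types are therefore determined by finite
tuples, and the classical counting argument for stable theories applies.

Stability in `μ` gives every type over `A` a set `B ⊆ A` of size at most `μ` over which it does not
split (`StableIn.exists_nonSplitting`). Otherwise a family of splittings grows into a binary tree of
embeddings of height `χ`, with `χ` least such that `μ < 2 ^ χ`. Its nodes span a set of size at most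
`μ`, while its `2 ^ χ` branches give distinct types over that set. The tree is built in an extension
from `SetAP.exists_qfHomogeneous`, which stands in for the monster model.

By stability for finite tuples (`StableIn.exists_tuple_representatives`), some `C ⊆ A` of size at
most `μ` realizes every type over `B` of a finite tuple of `A`. A type not splitting over `B` is
determined by its restriction to `C` (`NonSplitting.sameQF`). Hence there are at most `λ ^ μ * μ =
λ` types over `A`: choose `B`, then a type over `C`. -/

open FirstOrder FirstOrder.Language

/-! ### Quantifier-free types of tuples. -/

namespace FirstOrder.Language.BoundedFormula

theorem IsQF.restrictFreeVar {L : FirstOrder.Language} {α β : Type*} [DecidableEq α] {n : ℕ}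
    {φ : L.BoundedFormula α n} (h : φ.IsQF) (f : φ.freeVarFinset → β) :
    (φ.restrictFreeVar f).IsQF := by
  induction h with
  | falsum => exact isQF_bot
  | of_isAtomic h =>
    cases h with
    | equal t₁ t₂ => exact (IsAtomic.equal _ _).isQF
    | rel R ts => exact (IsAtomic.rel _ _).isQF
  | imp _ _ ih₁ ih₂ => exact (ih₁ _).imp (ih₂ _)

end FirstOrder.Language.BoundedFormula

/-- The tuples `v` and `w` (in possibly different structures) satisfy the same quantifier-free
formulas. -/
def SameQF (L : FirstOrder.Language) {X M N : Type*} [L.Structure M] [L.Structure N]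
    (v : X → M) (w : X → N) : Prop :=
  ∀ φ : L.Formula X, φ.IsQF → (φ.Realize v ↔ φ.Realize w)

namespace SameQF

variable {L : FirstOrder.Language} {X Y M N P : Type*} [L.Structure M] [L.Structure N]
  [L.Structure P]

theorem refl (v : X → M) : SameQF L v v := fun _ _ => Iff.rfl

theorem symm {v : X → M} {w : X → N} (h : SameQF L v w) : SameQF L w v :=
  fun φ hφ => (h φ hφ).symm

theorem trans {v : X → M} {w : X → N} {z : X → P} (h : SameQF L v w) (h' : SameQF L w z) :
    SameQF L v z :=
  fun φ hφ => (h φ hφ).trans (h' φ hφ)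

theorem embedding (f : M ↪[L] N) (v : X → M) : SameQF L v (f ∘ v) := fun φ hφ => by
  have := hφ.realize_embedding f (v := v) (xs := default)
  rw [Subsingleton.elim (f ∘ default : Fin 0 → N) default] at this
  exact this.symm

theorem comp {v : X → M} {w : X → N} (h : SameQF L v w) (s : Y → X) :
    SameQF L (v ∘ s) (w ∘ s) := fun φ hφ => by
  simpa [Formula.realize_relabel] using h (φ.relabel s) (BoundedFormula.IsQF.relabel hφ _)

theorem eq_iff {v : X → M} {w : X → N} (h : SameQF L v w) (x y : X) : v x = v y ↔ w x = w y := by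
  have := h (Term.equal (L := L) (Term.var x) (Term.var y))
    (BoundedFormula.IsAtomic.equal _ _).isQF
  simpa using this

/-- Quantifier-free equivalence is a local property: it only involves finite tuples. -/
theorem of_fin {v : X → M} {w : X → N}
    (h : ∀ (n : ℕ) (a : Fin n → X), SameQF L (v ∘ a) (w ∘ a)) : SameQF L v w := by
  classical
  intro φ hφ
  let e := φ.freeVarFinset.equivFin
  have key := h _ (fun i => (e.symm i : X)) (φ.restrictFreeVar e) (hφ.restrictFreeVar _)
  have hv := BoundedFormula.realize_restrictFreeVar (φ := φ) (f := e)
    (v := v ∘ fun i => (e.symm i : X)) (xs := default) v (by simp)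
  have hw := BoundedFormula.realize_restrictFreeVar (φ := φ) (f := e)
    (v := w ∘ fun i => (e.symm i : X)) (xs := default) w (by simp)
  exact hv.symm.trans (key.trans hw)

/-- Only finitely many entries matter at a time, so the embedding may change with the finite
subtuple. -/
theorem of_embedding {v : X → N} {w : X → M}
    (h : ∀ (n : ℕ) (a : Fin n → X), ∃ f : M ↪[L] N, ∀ i, f (w (a i)) = v (a i)) :
    SameQF L v w :=
  of_fin fun n a => by
    obtain ⟨f, hf⟩ := h n a
    have := (SameQF.embedding f (w ∘ a)).symm
    rwa [show f ∘ w ∘ a = v ∘ a from funext hf] at this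

end SameQF

/-! ### Calculus of `K`-embeddings, amalgamation and direct limits. -/

namespace AEC

variable {L : FirstOrder.Language.{u, u}} {K : AEC L} {M N P : Type u} [L.Structure M]
  [L.Structure N] [L.Structure P]

theorem IsEmb.mem_right {f : M ↪[L] N} (h : K.IsEmb f) : K.Mem N := (K.mem_of_strong h).2

theorem range_comp_toHom (g : N ↪[L] P) (f : M ↪[L] N) :
    (g.comp f).toHom.range = f.toHom.range.map g.toHom := by
  ext x
  simp [Hom.mem_range, Substructure.mem_map]

theorem isEmb_equiv (hM : K.Mem M) (e : M ≃[L] N) : K.IsEmb e.toEmbedding := by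
  have h : e.toEmbedding.toHom.range = ⊤ := by
    ext x
    simpa [Hom.mem_range] using e.surjective x
  unfold IsEmb
  rw [h]
  exact K.strong_top (K.mem_equiv e hM)

theorem IsEmb.equiv_comp {f : M ↪[L] N} (h : K.IsEmb f) (e : N ≃[L] P) :
    K.IsEmb (e.toEmbedding.comp f) := by
  unfold IsEmb
  rw [range_comp_toHom]
  exact K.strong_equiv e h

theorem range_comp_equiv (f : N ↪[L] P) (e : M ≃[L] N) :
    (f.comp e.toEmbedding).toHom.range = f.toHom.range := by
  ext x
  simp only [Hom.mem_range]
  exact ⟨fun ⟨y, hy⟩ => ⟨e y, hy⟩, fun ⟨y, hy⟩ => ⟨e.symm y, by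
    rw [← hy]; exact congrArg f (e.apply_symm_apply y)⟩⟩

theorem isEmb_comp_equiv_iff {f : N ↪[L] P} (e : M ≃[L] N) :
    K.IsEmb (f.comp e.toEmbedding) ↔ K.IsEmb f := by
  unfold IsEmb
  rw [range_comp_equiv]

theorem isEmb_subtype_iff {S : L.Substructure M} : K.IsEmb S.subtype ↔ K.Strong S := by
  unfold IsEmb
  rw [show S.subtype.toHom.range = S from S.range_subtype]

theorem range_inclusion {S T : L.Substructure M} (h : S ≤ T) :
    (Substructure.inclusion h).toHom.range = S.within T := by
  ext x
  simp only [Hom.mem_range, Substructure.within, Substructure.mem_comap]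
  constructor
  · rintro ⟨y, rfl⟩
    exact y.2
  · intro hx
    exact ⟨⟨x, hx⟩, Subtype.ext rfl⟩

theorem isEmb_inclusion_iff {S T : L.Substructure M} (h : S ≤ T) :
    K.IsEmb (Substructure.inclusion h) ↔ K.Strong (S.within T) := by
  unfold IsEmb
  rw [range_inclusion h]

theorem range_comp_le (g : N ↪[L] P) (f : M ↪[L] N) :
    (g.comp f).toHom.range ≤ g.toHom.range := by
  rintro _ ⟨y, rfl⟩
  exact ⟨f y, rfl⟩

theorem inclusion_comp_equivRange (g : N ↪[L] P) (f : M ↪[L] N) :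
    (Substructure.inclusion (range_comp_le g f)).comp (g.comp f).equivRange.toEmbedding =
      g.equivRange.toEmbedding.comp f := by
  ext x
  rfl

/-- Identifying `N` and `M` with their images in `P` turns the inclusion of images into `f`. This
carries the axioms on substructures over to embeddings. -/
theorem strong_within_range_comp_iff (g : N ↪[L] P) (f : M ↪[L] N) :
    K.Strong ((g.comp f).toHom.range.within g.toHom.range) ↔ K.IsEmb f := by
  rw [← isEmb_inclusion_iff (range_comp_le g f), ← isEmb_comp_equiv_iff (g.comp f).equivRange,
    inclusion_comp_equivRange]
  constructor
  · intro h
    have := h.equiv_comp g.equivRange.symm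
    convert this using 1
    ext x
    exact (g.equivRange.symm_apply_apply (f x)).symm
  · exact fun h => h.equiv_comp _

theorem IsEmb.comp {g : N ↪[L] P} {f : M ↪[L] N} (hg : K.IsEmb g) (hf : K.IsEmb f) :
    K.IsEmb (g.comp f) :=
  K.strong_trans (range_comp_le g f) ((strong_within_range_comp_iff g f).2 hf) hg

theorem IsEmb.of_comp {g : N ↪[L] P} {f : M ↪[L] N} (hg : K.IsEmb g) (h : K.IsEmb (g.comp f)) :
    K.IsEmb f :=
  (strong_within_range_comp_iff g f).1 (K.coherence (range_comp_le g f) h hg)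

/-- Amalgamation over a common tuple, whose entries need not be distinct. -/
theorem SetAP.exists_amalgam (hK : K.SetAP) (hM : K.Mem M) (hN : K.Mem N) {X : Type u} {v : X → M}
    {w : X → N} (h : SameQF L v w) :
    ∃ (P : Type u) (_ : L.Structure P) (g₁ : M ↪[L] P) (g₂ : N ↪[L] P),
      K.IsEmb g₁ ∧ K.IsEmb g₂ ∧ ∀ x, g₁ (v x) = g₂ (w x) := by
  -- Equalities between entries are quantifier-free, so `w` repeats an entry exactly where `v` does;
  -- one index per value of `v` therefore makes `w ∘ s` injective.
  let s : Set.range v → X := fun a => a.2.choose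
  have hs (a : Set.range v) : v (s a) = a := a.2.choose_spec
  have hinj : Function.Injective (w ∘ s) := fun a b hab => Subtype.ext <| by
    rw [← hs a, ← hs b]
    exact (h.eq_iff _ _).2 hab
  obtain ⟨P, _, g₁, g₂, h₁, h₂, h₃⟩ := hK (Set.range v) M N hM hN (Function.Embedding.subtype _)
    ⟨w ∘ s, hinj⟩ (by
      have := h.comp s
      rwa [show v ∘ s = Subtype.val from funext hs] at this)
  refine ⟨P, _, g₁, g₂, h₁, h₂, fun x => (h₃ ⟨v x, x, rfl⟩).trans ?_⟩
  exact congrArg g₂ ((h.eq_iff _ _).1 (hs ⟨v x, x, rfl⟩))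

/-- The union of a well-ordered chain of `K`-embeddings lies in `K`, and the members of the chain
are `K`-embedded in it. -/
theorem isEmb_directLimit_of {ι : Type u} [LinearOrder ι] [WellFoundedLT ι] [Nonempty ι]
    {G : ι → Type u} [∀ i, L.Structure (G i)] (f : ∀ i j, i ≤ j → G i ↪[L] G j)
    [DirectedSystem G fun i j h => f i j h] (hf : ∀ i j h, K.IsEmb (f i j h)) (i : ι) :
    K.IsEmb (Language.DirectLimit.of L ι G f i) := by
  let S (i : ι) : L.Substructure (Language.DirectLimit G f) := (Language.DirectLimit.of L ι G f i).toHom.range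
  have hof (i j : ι) (h : i ≤ j) :
      Language.DirectLimit.of L ι G f i = (Language.DirectLimit.of L ι G f j).comp (f i j h) := by
    ext x
    exact (Language.DirectLimit.of_f).symm
  have hmono : Monotone S := fun i j h => by
    change (Language.DirectLimit.of L ι G f i).toHom.range ≤ _
    rw [hof i j h]
    exact range_comp_le _ _
  have key := K.chain_union S hmono (fun i j h => by
    change K.Strong ((Language.DirectLimit.of L ι G f i).toHom.range.within _)
    rw [hof i j h]
    exact (strong_within_range_comp_iff _ _).2 (hf i j h)) i
  have htop : ⨆ j, S j = ⊤ := Language.DirectLimit.iSup_range_of_eq_top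
  rw [htop, ← isEmb_inclusion_iff le_top] at key
  have := (key.equiv_comp Substructure.topEquiv)
  rw [← isEmb_comp_equiv_iff (Language.DirectLimit.of L ι G f i).equivRange] at this
  convert this using 1
  ext x
  rfl

end AEC

/-! ### Transfinite construction. -/

/-- Transfinite recursion with a correctness condition at every stage. -/
theorem exists_forall_of_wellFoundedLT {J Q : Type*} [LinearOrder J] [WellFoundedLT J]
    (G : ∀ i : J, (Set.Iio i → Q) → Q → Prop)
    (H : ∀ (i : J) (s : Set.Iio i → Q),
      (∀ j : Set.Iio i, G j (fun k => s ⟨k, lt_trans k.2 j.2⟩) (s j)) → ∃ q, G i s q) :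
    ∃ s : J → Q, ∀ i, G i (fun k => s k) (s i) := by
  classical
  rcases isEmpty_or_nonempty J with hJ | hJ
  · exact ⟨fun i => hJ.elim i, fun i => hJ.elim i⟩
  have hQ : Nonempty Q := by
    obtain ⟨i, -, hi⟩ := WellFounded.has_min (wellFounded_lt (α := J)) Set.univ Set.univ_nonempty
    obtain ⟨q, -⟩ := H i (fun j => absurd j.2 (hi j trivial)) (fun j => absurd j.2 (hi j trivial))
    exact ⟨q⟩
  -- Choosing by `epsilon` needs no proof that the earlier stages are correct; correctness follows
  -- afterwards by induction.
  let F : ∀ i : J, (∀ j, j < i → Q) → Q := fun i ih =>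
    Classical.epsilon fun q => G i (fun k => ih k k.2) q
  let s : J → Q := IsWellFounded.fix (· < ·) F
  have hs (i : J) : s i = Classical.epsilon fun q => G i (fun k => s k) q :=
    IsWellFounded.fix_eq (· < ·) F i
  refine ⟨s, fun i => ?_⟩
  induction i using WellFoundedLT.induction with
  | ind i ih =>
    rw [hs i]
    exact Classical.epsilon_spec (H i (fun k => s k) fun j => ih j j.2)

/-! ### Models carried by subsets of a fixed set. -/

namespace AEC

variable {L : FirstOrder.Language.{u, u}} (K : AEC L)

/-- A member of `K` whose underlying set is a subset of `U`. -/
structure SubModel (U : Type u) where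
  carrier : Set U
  [str : L.Structure carrier]
  mem : K.Mem carrier

attribute [instance] SubModel.str

variable {K} {U : Type u}

namespace SubModel

/-- The inclusion of `p` into `q` is a `K`-embedding. -/
def le (p q : K.SubModel U) : Prop :=
  ∃ f : p.carrier ↪[L] q.carrier, K.IsEmb f ∧ ∀ x, (f x : U) = x

theorem le_refl (p : K.SubModel U) : p.le p :=
  ⟨(FirstOrder.Language.Equiv.refl L _).toEmbedding, isEmb_equiv p.mem _, fun _ => rfl⟩

theorem le.trans {p q r : K.SubModel U} (h : p.le q) (h' : q.le r) : p.le r := by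
  obtain ⟨f, hf, hf'⟩ := h
  obtain ⟨g, hg, hg'⟩ := h'
  exact ⟨g.comp f, hg.comp hf, fun x => (hg' _).trans (hf' x)⟩

theorem le.subset {p q : K.SubModel U} (h : p.le q) : p.carrier ⊆ q.carrier := by
  obtain ⟨f, hf, hf'⟩ := h
  intro x hx
  have := (f ⟨x, hx⟩).2
  rwa [hf'] at this

theorem le.sameQF {p q : K.SubModel U} (h : p.le q) {X : Type*} (v : X → U)
    (hp : ∀ x, v x ∈ p.carrier) (hq : ∀ x, v x ∈ q.carrier) :
    SameQF L (fun x => (⟨v x, hp x⟩ : p.carrier)) (fun x => (⟨v x, hq x⟩ : q.carrier)) := by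
  obtain ⟨f, hf, hf'⟩ := h
  have := SameQF.embedding f (fun x => (⟨v x, hp x⟩ : p.carrier))
  rwa [show (f ∘ fun x => (⟨v x, hp x⟩ : p.carrier)) = fun x => (⟨v x, hq x⟩ : q.carrier) from
    funext fun x => Subtype.ext (hf' _)] at this

theorem exists_of_injective {N : Type u} [L.Structure N] (hN : K.Mem N) (k : N ↪ U) :
    ∃ q : K.SubModel U, q.carrier = Set.range k ∧ ∃ e : N ≃[L] q.carrier, ∀ x, (e x : U) = k x := by
  let e := Equiv.ofInjective k k.injective
  let _ := e.inducedStructure (L := L)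
  exact ⟨⟨Set.range k, K.mem_equiv e.inducedStructureEquiv hN⟩, rfl, e.inducedStructureEquiv,
    fun _ => rfl⟩

/-- All transition maps are inclusions in `U`, so elements of the direct limit are identified
exactly when they are the same point of `U`; the limit can be copied onto the literal union. -/
theorem exists_iUnion {ι : Type u} [LinearOrder ι] [WellFoundedLT ι] [Nonempty ι]
    (s : ι → K.SubModel U) (hs : ∀ i j, i ≤ j → (s i).le (s j)) :
    ∃ q : K.SubModel U, q.carrier = ⋃ i, (s i).carrier ∧ ∀ i, (s i).le q := by
  choose f hf hf' using hs
  have : DirectedSystem (fun i => (s i).carrier) fun i j h => f i j h :=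
    ⟨fun i x => Subtype.ext (hf' _ _ _ _), fun i j k hij hjk x => Subtype.ext <| by
      rw [hf', hf', hf']⟩
  let D := Language.DirectLimit (fun i => (s i).carrier) f
  let of (i : ι) : (s i).carrier ↪[L] D := Language.DirectLimit.of L ι _ f i
  have hof (i : ι) : K.IsEmb (of i) := isEmb_directLimit_of f hf i
  have hcompat (i j : ι) (h : i ≤ j) (x) : of j (f i j h x) = of i x :=
    Language.DirectLimit.of_f
  have hex (z : D) : ∃ i x, of i x = z := Language.DirectLimit.exists_of z
  choose idx rep hrep using hex
  have key (i j : ι) (x : (s i).carrier) (y : (s j).carrier) :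
      of i x = of j y ↔ (x : U) = y := by
    rw [← hcompat i (max i j) (le_max_left _ _), ← hcompat j (max i j) (le_max_right _ _),
      (of _).injective.eq_iff, Subtype.ext_iff, hf', hf']
  let k : D ↪ U := ⟨fun z => rep z, fun z z' h => by
    rw [← hrep z, ← hrep z']
    exact (key _ _ _ _).2 h⟩
  have hk (i : ι) (x : (s i).carrier) : k (of i x) = x := (key _ _ _ _).1 (hrep _)
  obtain ⟨q, hq, e, he⟩ := exists_of_injective (hof (Classical.arbitrary ι)).mem_right k
  refine ⟨q, ?_, fun i => ⟨e.toEmbedding.comp (of i), (hof i).equiv_comp e, fun x =>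
    (he _).trans (hk i x)⟩⟩
  rw [hq]
  ext u
  simp only [Set.mem_range, Set.mem_iUnion]
  constructor
  · rintro ⟨z, rfl⟩
    exact ⟨idx z, (rep z).2⟩
  · rintro ⟨i, hi⟩
    exact ⟨of i ⟨u, hi⟩, hk i _⟩

/-- If there is enough room in `U`, then a `K`-embedding `g` of `p` can be turned into an
inclusion. -/
theorem exists_le_of_isEmb (p : K.SubModel U) {N : Type u} [L.Structure N]
    {g : p.carrier ↪[L] N} (hg : K.IsEmb g) (hcard : #N ≤ #(p.carrierᶜ : Set U)) :
    ∃ q : K.SubModel U, p.le q ∧ ∃ e : N ≃[L] q.carrier, ∀ x, (e (g x) : U) = x := by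
  classical
  obtain ⟨j⟩ := hcard
  -- Undo `g` on its image and send everything else outside `p.carrier`, so the two cases never
  -- collide.
  let k : N → U := fun n => if h : ∃ x, g x = n then (h.choose : U) else j n
  have hk (x : p.carrier) : k (g x) = x := by
    have h : ∃ y, g y = g x := ⟨x, rfl⟩
    have : k (g x) = h.choose := dif_pos h
    rw [this, g.injective h.choose_spec]
  have hk' (n : N) (h : ¬ ∃ x, g x = n) : k n = j n := dif_neg h
  have hinj : Function.Injective k := by
    intro n n' h
    by_cases hn : ∃ x, g x = n <;> by_cases hn' : ∃ x, g x = n'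
    · obtain ⟨x, rfl⟩ := hn
      obtain ⟨x', rfl⟩ := hn'
      rw [hk, hk] at h
      rw [Subtype.ext h]
    · obtain ⟨x, rfl⟩ := hn
      rw [hk, hk' _ hn'] at h
      exact absurd x.2 (h ▸ (j n').2)
    · obtain ⟨x, rfl⟩ := hn'
      rw [hk, hk' _ hn] at h
      exact absurd x.2 (h ▸ (j n).2)
    · rw [hk' _ hn, hk' _ hn'] at h
      exact j.injective (Subtype.ext h)
  obtain ⟨q, hq, e, he⟩ := exists_of_injective hg.mem_right ⟨k, hinj⟩
  exact ⟨q, ⟨e.toEmbedding.comp g, hg.equiv_comp e, fun x => (he _).trans (hk x)⟩, e,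
    fun x => (he _).trans (hk x)⟩

/-- One step in the construction of a homogeneous extension. -/
theorem exists_le_realizing (hK : K.SetAP) {M : Type u} [L.Structure M] (hM : K.Mem M)
    {θ : Cardinal.{u}} (hθ : ℵ₀ ≤ θ)
    (hLS : ∀ {N : Type u} [L.Structure N], K.Mem N → ∀ A : Set N,
      ∃ S : L.Substructure N, A ⊆ (S : Set N) ∧ K.Strong S ∧ #S ≤ #A + θ)
    (hMθ : #M ≤ θ) (hU : θ < #U) (p : K.SubModel U) (hp : #p.carrier < #U)
    {X : Type u} (v : X → U) (w : X → M) (hv : ∀ x, v x ∈ p.carrier)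
    (h : SameQF L (fun x => (⟨v x, hv x⟩ : p.carrier)) w) :
    ∃ q : K.SubModel U, p.le q ∧ #q.carrier ≤ max #p.carrier θ ∧
      ∃ f : M ↪[L] q.carrier, ∀ x, (f (w x) : U) = v x := by
  obtain ⟨N, _, g₁, g₂, hg₁, -, hg⟩ := hK.exists_amalgam p.mem hM h
  -- The amalgam may be too large for `U`; only a small strong submodel containing both images is
  -- kept.
  obtain ⟨S, hAS, hS, hcard⟩ := hLS hg₁.mem_right (Set.range g₁ ∪ Set.range g₂)
  have hcard' : #S ≤ max #p.carrier θ := by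
    refine hcard.trans (Cardinal.add_le_of_le (hθ.trans (le_max_right _ _)) ?_ (le_max_right _ _))
    refine (Cardinal.mk_union_le _ _).trans
      (Cardinal.add_le_of_le (hθ.trans (le_max_right _ _)) ?_ ?_)
    · exact Cardinal.mk_range_le.trans (le_max_left _ _)
    · exact Cardinal.mk_range_le.trans (hMθ.trans (le_max_right _ _))
  have h₁ (x) : g₁ x ∈ S := hAS (Or.inl ⟨x, rfl⟩)
  have h₂ (x) : g₂ x ∈ S := hAS (Or.inr ⟨x, rfl⟩)
  have hemb : K.IsEmb (g₁.codRestrict S h₁) := by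
    refine IsEmb.of_comp (g := S.subtype) (isEmb_subtype_iff.2 hS) ?_
    rwa [Embedding.subtype_comp_codRestrict]
  have : Infinite U := Cardinal.infinite_iff.2 (hθ.trans hU.le)
  have hroom : #S ≤ #(p.carrierᶜ : Set U) := by
    rw [Cardinal.mk_compl_of_infinite _ hp]
    exact hcard'.trans (max_lt hp hU).le
  obtain ⟨q, hq, e, he⟩ := p.exists_le_of_isEmb hemb hroom
  refine ⟨q, hq, ?_, e.toEmbedding.comp (g₂.codRestrict S h₂), fun x => ?_⟩
  · rwa [← Cardinal.mk_congr e.toEquiv]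
  · refine Eq.trans ?_ (he ⟨v x, hv x⟩)
    exact congrArg (fun z => (e z : U)) (Subtype.ext (hg x).symm)

end SubModel

end AEC

/-! ### Homogeneous extensions. -/

/-- Every `μ`-small tuple of `N` having the quantifier-free type of a tuple of `M` is the image of
that tuple under an embedding of `M` into `N`. -/
def QFHomogeneous (L : FirstOrder.Language.{u, u}) (μ : Cardinal.{u}) (M N : Type u) [L.Structure M]
    [L.Structure N] : Prop :=
  ∀ (X : Type u) (v : X → N) (w : X → M), #X ≤ μ → SameQF L v w →
    ∃ f : M ↪[L] N, ∀ x, f (w x) = v x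

/-- Project a bijection of `J` with `J × T`: each fibre has size `#J`, hence fits in no proper
initial segment. This is the bookkeeping that revisits every task cofinally. -/
theorem Cardinal.exists_surjective_unbounded_fiber {J T : Type u} [LinearOrder J] [WellFoundedLT J]
    (hJ : ℵ₀ ≤ #J) (hIic : ∀ i : J, #(Set.Iic i) < #J) (hT : #T ≤ #J) [Nonempty T] :
    ∃ e : J → T, ∀ t i, ∃ j, i < j ∧ e j = t := by
  have hcard : #(J × T) = #J := by
    rw [Cardinal.mk_prod, Cardinal.lift_id, Cardinal.lift_id]
    exact Cardinal.mul_eq_left hJ hT (Cardinal.mk_ne_zero T)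
  obtain ⟨φ⟩ := Cardinal.eq.1 hcard
  refine ⟨fun j => (φ.symm j).2, fun t i => ?_⟩
  by_contra! hcon
  have hinj : Function.Injective fun j : J => φ (j, t) := fun a b h =>
    congrArg Prod.fst (φ.injective h)
  have hsub : Set.range (fun j : J => φ (j, t)) ⊆ Set.Iic i := by
    rintro _ ⟨j, rfl⟩
    by_contra hlt
    exact hcon (φ (j, t)) (not_le.1 hlt) (by simp)
  have := (Cardinal.mk_le_mk_of_subset hsub).trans_lt (hIic i)
  rw [Cardinal.mk_range_eq _ hinj] at this
  exact this.false

namespace AEC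

variable {L : FirstOrder.Language.{u, u}} {K : AEC L}

/-- Under amalgamation over sets, every model has an extension realizing all small configurations
of the model over arbitrary small copies. -/
theorem SetAP.exists_qfHomogeneous (hK : K.SetAP) {M : Type u} [L.Structure M] (hM : K.Mem M)
    {μ : Cardinal.{u}} (hμ : ℵ₀ ≤ μ) :
    ∃ (N : Type u) (_ : L.Structure N), K.Mem N ∧ Nonempty (M ↪[L] N) ∧ QFHomogeneous L μ M N := by
  classical
  obtain ⟨κ₀, -, -, hLS₀⟩ := K.exists_LS
  let θ : Cardinal.{u} := max (max #M μ) κ₀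
  have hMθ : #M ≤ θ := (le_max_left _ _).trans (le_max_left _ _)
  have hμθ : μ ≤ θ := (le_max_right _ _).trans (le_max_left _ _)
  have hθ : ℵ₀ ≤ θ := hμ.trans hμθ
  have hLS {N : Type u} [L.Structure N] (hN : K.Mem N) (A : Set N) :
      ∃ S : L.Substructure N, A ⊆ (S : Set N) ∧ K.Strong S ∧ #S ≤ #A + θ := by
    obtain ⟨S, h₁, h₂, h₃⟩ := hLS₀ hN A
    exact ⟨S, h₁, h₂, h₃.trans (by gcongr; exact le_max_right _ _)⟩
  -- `J` is both the universe and the index set of the chain. The value `2 ^ θ` is chosen so that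
  -- there are only `#J` tasks indexed by `μ`, and its cofinality exceeds `θ ≥ μ`.
  let J : Type u := ((2 : Cardinal.{u}) ^ θ).ord.ToType
  have hJ : #J = 2 ^ θ := Cardinal.mk_ord_toType _
  have hθJ : θ < #J := hJ ▸ Cardinal.cantor θ
  have hJ₀ : ℵ₀ ≤ #J := hθ.trans hθJ.le
  have hIio (i : J) : #(Set.Iio i) < #J := 
    Cardinal.mk_Iio_lt i (by rw [hJ]; exact (Ordinal.type_toType _).symm)
  have hIic (i : J) : #(Set.Iic i) < #J := by
    rw [← Set.Iio_insert]
    exact Cardinal.mk_insert_le.trans_lt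
      (Cardinal.add_lt_of_lt hJ₀ (hIio i) (Cardinal.one_lt_aleph0.trans_le hJ₀))
  let X : Type u := μ.out
  have hX : #X = μ := Cardinal.mk_out μ
  have hpow {A : Type u} (hA : #A ≤ #J) : #(X → A) ≤ #J := by
    calc #(X → A) = #A ^ #X := by simp
      _ ≤ (2 ^ θ) ^ μ := by rw [hX]; exact Cardinal.power_le_power_right (hJ ▸ hA)
      _ = #J := by rw [← Cardinal.power_mul, Cardinal.mul_eq_left hθ hμθ
        (Cardinal.aleph0_pos.trans_le hμ).ne', hJ]
  rcases isEmpty_or_nonempty M with hM₀ | hM₀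
  · refine ⟨M, _, hM, ⟨Embedding.refl L M⟩, fun Y v w _ _ => ⟨Embedding.refl L M, fun x => hM₀.elim (w x)⟩⟩
  have hJne : Nonempty J := Cardinal.mk_ne_zero_iff.1 (Cardinal.aleph0_pos.trans_le hJ₀).ne'
  obtain ⟨e, he⟩ := Cardinal.exists_surjective_unbounded_fiber (J := J)
    (T := (X → J) × (X → M)) hJ₀ hIic (by
      rw [Cardinal.mk_prod, Cardinal.lift_id, Cardinal.lift_id]
      exact Cardinal.mul_le_of_le hJ₀ (hpow le_rfl) (hpow (hMθ.trans hθJ.le)))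
  obtain ⟨k₀⟩ : #M ≤ #J := hMθ.trans hθJ.le
  obtain ⟨p₀, hp₀, e₀, -⟩ := SubModel.exists_of_injective hM k₀
  have hp₀θ : #p₀.carrier ≤ θ := by rwa [← Cardinal.mk_congr e₀.toEquiv]
  -- The size bound keeps every stage below `#J`, leaving room for the next one. A task is handled
  -- only if its tuple already lies in an earlier stage with the right type.
  let G (i : J) (s : Set.Iio i → K.SubModel J) (q : K.SubModel J) : Prop :=
    p₀.le q ∧ (∀ j, (s j).le q) ∧ #q.carrier ≤ max θ #(Set.Iio i) ∧
      ∀ (j : Set.Iio i) (hv : ∀ x, (e i).1 x ∈ (s j).carrier),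
        SameQF L (fun x => (⟨(e i).1 x, hv x⟩ : (s j).carrier)) (e i).2 →
        ∃ f : M ↪[L] q.carrier, ∀ x, (f ((e i).2 x) : J) = (e i).1 x
  obtain ⟨s, hs⟩ := exists_forall_of_wellFoundedLT G fun i s hs => by
    have hmono (j j' : Set.Iio i) (h : j ≤ j') : (s j).le (s j') := by
      rcases h.eq_or_lt with rfl | h
      · exact SubModel.le_refl _
      · exact (hs j').2.1 ⟨j, h⟩
    obtain ⟨r, hr₀, hr, hrc⟩ : ∃ r : K.SubModel J, p₀.le r ∧ (∀ j, (s j).le r) ∧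
        #r.carrier ≤ max θ #(Set.Iio i) := by
      rcases isEmpty_or_nonempty (Set.Iio i) with hi | hi
      · exact ⟨p₀, SubModel.le_refl _, fun j => hi.elim j, hp₀θ.trans (le_max_left _ _)⟩
      · obtain ⟨r, hr, hr'⟩ := SubModel.exists_iUnion s hmono
        refine ⟨r, (hs hi.some).1.trans (hr' hi.some), hr', ?_⟩
        rw [hr]
        refine (Cardinal.mk_iUnion_le _).trans (Cardinal.mul_le_of_le
          (hθ.trans (le_max_left _ _)) (le_max_right _ _) (ciSup_le' fun j => ?_))
        refine (hs j).2.2.1.trans (max_le_max le_rfl (Cardinal.mk_le_mk_of_subset ?_))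
        exact Set.Iio_subset_Iio (le_of_lt j.2)
    by_cases htask : ∃ (j : Set.Iio i) (hv : ∀ x, (e i).1 x ∈ (s j).carrier),
        SameQF L (fun x => (⟨(e i).1 x, hv x⟩ : (s j).carrier)) (e i).2
    · obtain ⟨j, hv, hj⟩ := htask
      obtain ⟨q, hq, hqc, hqf⟩ := r.exists_le_realizing hK hM hθ hLS hMθ hθJ
        (hrc.trans_lt (max_lt hθJ (hIio i))) (e i).1 (e i).2 (fun x => (hr j).subset (hv x))
        (((hr j).sameQF _ _ _).symm.trans hj)
      exact ⟨q, hr₀.trans hq, fun j => (hr j).trans hq,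
        hqc.trans (max_le hrc (le_max_left _ _)), fun _ _ _ => hqf⟩
    · exact ⟨r, hr₀, hr, hrc, fun j hv h => absurd ⟨j, hv, h⟩ htask⟩
  have hmono (i j : J) (h : i ≤ j) : (s i).le (s j) := by
    rcases h.eq_or_lt with rfl | h
    · exact SubModel.le_refl _
    · exact (hs j).2.1 ⟨i, h⟩
  obtain ⟨q, hq, hq'⟩ := SubModel.exists_iUnion s hmono
  obtain ⟨f₀, -⟩ := (hs hJne.some).1.trans (hq' hJne.some)
  refine ⟨q.carrier, _, q.mem, ⟨f₀.comp e₀.toEmbedding⟩, fun Y v w hY h => ?_⟩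
  rcases isEmpty_or_nonempty Y with hY₀ | hY₀
  · exact ⟨f₀.comp e₀.toEmbedding, fun y => hY₀.elim y⟩
  obtain ⟨g, hg⟩ : ∃ g : X → Y, Function.Surjective g := by
    rw [← hX] at hY
    obtain ⟨i⟩ := hY
    exact ⟨Function.invFun i, Function.invFun_surjective i.injective⟩
  obtain ⟨i, hi⟩ : ∃ i, ∀ x, (v (g x) : J) ∈ (s i).carrier := by
    have hx (x : X) : ∃ i, (v (g x) : J) ∈ (s i).carrier :=
      Set.mem_iUnion.1 (hq ▸ (v (g x)).2)
    choose ix hix using hx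
    -- At most `μ` stages cannot be cofinal in `2 ^ θ`, by König's theorem.
    have hbdd : ∃ i, ∀ x, ix x ≤ i := by
      by_contra! hcon
      have hcof : IsCofinal (Set.range ix) := fun i => by
        obtain ⟨x, hx⟩ := hcon i
        exact ⟨ix x, ⟨x, rfl⟩, hx.le⟩
      have h₁ := (Order.cof_le hcof).trans Cardinal.mk_range_le
      rw [hX, Ordinal.cof_toType] at h₁
      exact (h₁.trans hμθ).not_gt (Cardinal.lt_cof_ord_power hθ Cardinal.one_lt_two)
    obtain ⟨i, hi⟩ := hbdd
    exact ⟨i, fun x => (hmono _ _ (hi x)).subset (hix x)⟩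
  obtain ⟨j, hij, hj⟩ := he (fun x => (v (g x) : J), w ∘ g) i
  have h₁ := (hs j).2.2.2
  rw [hj] at h₁
  obtain ⟨f, hf⟩ := h₁ ⟨i, hij⟩ hi
    (((hq' i).sameQF _ _ fun x => (v (g x)).2).trans (h.comp g))
  obtain ⟨ι, -, hι⟩ := hq' j
  refine ⟨ι.comp f, fun y => ?_⟩
  obtain ⟨x, rfl⟩ := hg y
  exact Subtype.ext ((hι _).trans (hf x))

end AEC

/-! ### Galois types as quantifier-free types; stability for tuples. -/

/-- The tuple enumerating the set `A` followed by `a`; its quantifier-free type is the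
quantifier-free type of `a` over `A`. -/
abbrev tupleOver {M : Type*} (A : Set M) {Y : Type*} (a : Y → M) : A ⊕ Y → M :=
  Sum.elim Subtype.val a

/-- If `SameQF` over `A` is known, then so it is for any tuples from `A`. -/
theorem SameQF.of_tupleOver {L : FirstOrder.Language} {M X Y : Type*} [L.Structure M] {A : Set M}
    {a b : Y → M} (h : SameQF L (tupleOver A a) (tupleOver A b)) (c : X → M) (hc : ∀ x, c x ∈ A) :
    SameQF L (Sum.elim c a) (Sum.elim c b) := by
  have := h.comp (Sum.map (fun x => (⟨c x, hc x⟩ : A)) id)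
  simp only [Sum.elim_comp_map, Function.comp_id] at this
  exact this

/-- Take one preimage of each attained code: counting classes reduces to coding them. -/
theorem exists_representatives {α T : Type u} (E : α → α → Prop) (key : α → T)
    (h : ∀ a b, key a = key b → E a b) :
    ∃ R : Set α, #R ≤ #T ∧ ∀ a, ∃ r ∈ R, E a r := by
  refine ⟨Set.range fun t : Set.range key => t.2.choose,
    Cardinal.mk_range_le.trans (Cardinal.mk_set_le _), fun a => ?_⟩
  exact ⟨_, ⟨⟨key a, a, rfl⟩, rfl⟩,
    h _ _ (Exists.choose_spec (⟨key a, a, rfl⟩ : Set.range key).2).symm⟩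

namespace AEC

variable {L : FirstOrder.Language.{u, u}} {K : AEC L}

theorem AtomicEquiv.sameQF {A : Type u} {p q : K.Triple A} (h : K.AtomicEquiv p q) :
    SameQF L (Sum.elim p.base fun _ : Unit => p.pt) (Sum.elim q.base fun _ : Unit => q.pt) := by
  obtain ⟨N, _, f, g, -, -, h₁, h₂⟩ := h
  have hf := SameQF.embedding f (Sum.elim p.base fun _ : Unit => p.pt)
  have hg := SameQF.embedding g (Sum.elim q.base fun _ : Unit => q.pt)
  have : (f ∘ Sum.elim p.base fun _ : Unit => p.pt) = g ∘ Sum.elim q.base fun _ : Unit => q.pt := by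
    funext x
    rcases x with x | x
    · exact h₁ x
    · exact h₂
  rw [this] at hf
  exact hf.trans hg.symm

/-- Under amalgamation over sets, Galois types are quantifier-free types. -/
theorem SetAP.gtp_eq_iff (hK : K.SetAP) {M : Type u} [L.Structure M] (hM : K.Mem M) (A : Set M)
    (x y : M) :
    K.gtp hM A x = K.gtp hM A y ↔
      SameQF L (tupleOver A fun _ : Unit => x) (tupleOver A fun _ : Unit => y) := by
  constructor
  · have key (p q : K.Triple A) (h : Relation.EqvGen K.AtomicEquiv p q) :
        SameQF L (Sum.elim p.base fun _ : Unit => p.pt) (Sum.elim q.base fun _ : Unit => q.pt) := by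
      induction h with
      | rel _ _ h => exact h.sameQF
      | refl _ => exact SameQF.refl _
      | symm _ _ _ ih => exact ih.symm
      | trans _ _ _ _ _ ih₁ ih₂ => exact ih₁.trans ih₂
    exact fun h => key _ _ (Quot.eqvGen_exact h)
  · intro h
    obtain ⟨N, _, f, g, hf, hg, hfg⟩ := hK.exists_amalgam hM hM h
    exact Quot.sound ⟨N, _, f, g, hf, hg, fun a => hfg (Sum.inl a), hfg (Sum.inr ())⟩

/-- Stability says that the types over a small set have a small set of representatives. -/
theorem SetAP.stableIn_iff (hK : K.SetAP) {κ : Cardinal.{u}} :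
    K.StableIn κ ↔ ∀ (M : Type u) [L.Structure M], K.Mem M → ∀ A : Set M, #A ≤ κ →
      ∃ R : Set M, #R ≤ κ ∧ ∀ x, ∃ r ∈ R,
        SameQF L (tupleOver A fun _ : Unit => x) (tupleOver A fun _ : Unit => r) := by
  constructor
  · intro h M _ hM A hA
    have hcard := h M hM A hA
    let rep : K.gS hM A → M := fun p => p.2.choose
    have hrep (p : K.gS hM A) : K.gtp hM A (rep p) = p := p.2.choose_spec
    refine ⟨Set.range rep, ?_, fun x => ⟨rep ⟨_, x, rfl⟩, ⟨_, rfl⟩, ?_⟩⟩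
    · have := Cardinal.mk_range_le_lift (f := rep)
      rw [← Cardinal.lift_le.{u + 1}]
      refine this.trans ?_
      exact (Cardinal.lift_id'.{u, u + 1} _).trans_le hcard
    · rw [← hK.gtp_eq_iff hM, hrep]
  · intro h M _ hM A hA
    obtain ⟨R, hR, hR'⟩ := h M hM A hA
    have hsub : K.gS hM A ⊆ Set.range fun r : R => K.gtp hM A r := by
      rintro _ ⟨x, rfl⟩
      obtain ⟨r, hr, hxr⟩ := hR' x
      exact ⟨⟨r, hr⟩, ((hK.gtp_eq_iff hM A x r).2 hxr).symm⟩
    refine (Cardinal.mk_le_mk_of_subset hsub).trans ?_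
    have := Cardinal.mk_range_le_lift (f := fun r : R => K.gtp hM A r)
    exact (Cardinal.lift_id'.{u, u + 1} _).symm.trans_le
      (this.trans (Cardinal.lift_le.{u + 1}.2 hR))

/-- Stability for elements implies stability for finite tuples. -/
theorem StableIn.exists_tuple_representatives (hK : K.SetAP) {μ : Cardinal.{u}} (hμ : ℵ₀ ≤ μ)
    (hs : K.StableIn μ) {M : Type u} [L.Structure M] (hM : K.Mem M) {A : Set M} (hA : #A ≤ μ)
    (n : ℕ) :
    ∃ R : Set (Fin n → M), #R ≤ μ ∧ ∀ a, ∃ r ∈ R, SameQF L (tupleOver A a) (tupleOver A r) := by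
  induction n with
  | zero =>
    refine ⟨Set.univ, (Cardinal.le_one_iff_subsingleton.2 inferInstance).trans
      (Cardinal.one_le_aleph0.trans hμ), fun a => ⟨a, trivial, SameQF.refl _⟩⟩
  | succ n ih =>
    obtain ⟨R, hR, hrep⟩ := ih
    obtain ⟨N, _, hN, ⟨f₀⟩, hhom⟩ := hK.exists_qfHomogeneous hM hμ
    -- Each tuple is moved so that its first `n` entries land on their representative. Its type is
    -- then coded by that representative and the type over `D` of the moved last entry.
    let D : Set N := f₀ '' (A ∪ ⋃ r : R, Set.range (r : Fin n → M))
    have hD : #D ≤ μ := by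
      refine Cardinal.mk_image_le.trans ((Cardinal.mk_union_le _ _).trans
        (Cardinal.add_le_of_le hμ hA ?_))
      refine (Cardinal.mk_iUnion_le _).trans (Cardinal.mul_le_of_le hμ hR (ciSup_le' fun r => ?_))
      exact (Set.countable_range (r : Fin n → M)).le_aleph0.trans hμ
    obtain ⟨R', hR', hrep'⟩ := hK.stableIn_iff.1 hs N hN D hD
    choose r hr hrs using hrep
    have hemb (a : Fin (n + 1) → M) : ∃ f : M ↪[L] N, ∀ x,
        f (tupleOver A (a ∘ Fin.castSucc) x) = f₀ (tupleOver A (r (a ∘ Fin.castSucc)) x) := by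
      refine hhom _ (f₀ ∘ tupleOver A (r (a ∘ Fin.castSucc))) (tupleOver A (a ∘ Fin.castSucc)) ?_
        ((SameQF.embedding f₀ _).symm.trans (hrs _).symm)
      rw [Cardinal.mk_sum]
      simpa using Cardinal.add_le_of_le hμ hA ((Cardinal.natCast_lt_aleph0 (n := n)).le.trans hμ)
    choose f hf using hemb
    choose t ht hts using fun a => hrep' (f a (a (Fin.last n)))
    obtain ⟨S, hS, hSrep⟩ := exists_representatives
      (fun a b : Fin (n + 1) → M => SameQF L (tupleOver A a) (tupleOver A b))
      (fun a => ((⟨r (a ∘ Fin.castSucc), hr _⟩, ⟨t a, ht a⟩) : R × R')) (by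
        intro a b hab
        have hab₁ : r (a ∘ Fin.castSucc) = r (b ∘ Fin.castSucc) :=
          congrArg (fun p => (p.1 : Fin n → M)) hab
        have hab₂ : t a = t b := congrArg (fun p => (p.2 : N)) hab
        have h₁ : SameQF L (tupleOver D fun _ : Unit => f a (a (Fin.last n)))
            (tupleOver D fun _ : Unit => f b (b (Fin.last n))) :=
          (hts a).trans (hab₂ ▸ (hts b).symm)
        have h₂ := h₁.of_tupleOver (f₀ ∘ tupleOver A (r (a ∘ Fin.castSucc))) (by
          rintro (x | x)
          · exact ⟨x, Or.inl x.2, rfl⟩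
          · exact ⟨_, Or.inr (Set.mem_iUnion.2 ⟨⟨_, hr _⟩, x, rfl⟩), rfl⟩)
        let σ : A ⊕ Fin (n + 1) → (A ⊕ Fin n) ⊕ Unit :=
          Sum.elim (fun x => .inl (.inl x)) (Fin.lastCases (.inr ()) fun i => .inl (.inr i))
        have hσ (c : Fin (n + 1) → M) (hc : r (c ∘ Fin.castSucc) = r (a ∘ Fin.castSucc)) :
            (Sum.elim (f₀ ∘ tupleOver A (r (a ∘ Fin.castSucc)))
              fun _ : Unit => f c (c (Fin.last n))) ∘ σ = f c ∘ tupleOver A c := by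
          funext x
          rcases x with x | x
          · have := hf c (.inl x)
            simpa [σ] using this.symm
          · refine Fin.lastCases ?_ (fun i => ?_) x
            · simp [σ]
            · have := hf c (.inr i)
              rw [hc] at this
              simpa [σ] using this.symm
        have h₃ := h₂.comp σ
        rw [hσ a rfl, hσ b hab₁.symm] at h₃
        exact ((SameQF.embedding (f a) _).trans h₃).trans (SameQF.embedding (f b) _).symm)
    refine ⟨S, hS.trans ?_, hSrep⟩
    rw [Cardinal.mk_prod, Cardinal.lift_id, Cardinal.lift_id]
    exact Cardinal.mul_le_of_le hμ hR hR'

end AEC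

/-! ### Splitting and trees of embeddings. -/

/-- The quantifier-free type of `x` over `A` does not split over `B`: finite tuples of `A` with the
same type over `B` also have the same type over `x`. -/
def NonSplitting (L : FirstOrder.Language) {M : Type*} [L.Structure M] (A B : Set M) (x : M) :
    Prop :=
  ∀ (n : ℕ) (c d : Fin n → M), (∀ k, c k ∈ A) → (∀ k, d k ∈ A) →
    SameQF L (tupleOver B c) (tupleOver B d) →
    SameQF L (Sum.elim c fun _ : Unit => x) (Sum.elim d fun _ : Unit => x)

/-- A coherent family of partial embeddings has a common extension which preserves
quantifier-free formulas. -/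
theorem SameQF.of_coherent {L : FirstOrder.Language} {M N ι : Type*} [L.Structure M] [L.Structure N]
    [LinearOrder ι] (hne : Nonempty (M ↪[L] N)) (S : ι → Set M) (E : ι → M ↪[L] N)
    (hE : ∀ i j, i < j → ∀ m ∈ S i, E j m = E i m) :
    SameQF L (fun p : Σ i, S i => E p.1 p.2) (fun p : Σ i, S i => (p.2 : M)) := by
  refine SameQF.of_embedding fun n a => ?_
  rcases isEmpty_or_nonempty (Fin n) with hn | hn
  · exact ⟨hne.some, fun i => hn.elim i⟩
  · obtain ⟨k, hk⟩ := Finite.exists_max fun i => (a i).1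
    refine ⟨E (a k).1, fun i => ?_⟩
    rcases (hk i).eq_or_lt with h | h
    · exact congrArg (fun j => E j (a i).2) h.symm
    · exact hE _ _ h _ (a i).2.2

namespace Cardinal

/-- The least `χ` with `μ < 2 ^ χ`. -/
theorem exists_least_two_power {μ : Cardinal.{u}} (hμ : ℵ₀ ≤ μ) :
    ∃ χ : Cardinal.{u}, ℵ₀ ≤ χ ∧ χ ≤ μ ∧ μ < 2 ^ χ ∧ ∀ c < χ, (2 : Cardinal.{u}) ^ c ≤ μ := by
  let s : Set Cardinal.{u} := {c | μ < 2 ^ c}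
  have hs : s.Nonempty := ⟨μ, Cardinal.cantor μ⟩
  have hmem : μ < 2 ^ sInf s := csInf_mem hs
  refine ⟨sInf s, ?_, csInf_le' (Cardinal.cantor μ), hmem, fun c hc => not_lt.1 fun h =>
    (csInf_le' (s := s) h).not_gt hc⟩
  by_contra! h
  exact (hmem.trans (Cardinal.power_lt_aleph0 Cardinal.ofNat_lt_aleph0 h)).not_ge hμ

end Cardinal

/-- A family of splittings of the type of `x`, each over the union of the previous ones. -/
theorem exists_splitting_family {L : FirstOrder.Language.{u, u}} {M : Type u} [L.Structure M]
    {A : Set M} {x : M} {μ : Cardinal.{u}} (hμ : ℵ₀ ≤ μ)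
    (hsplit : ∀ B ⊆ A, #B ≤ μ → ¬ NonSplitting L A B x) {J : Type u} [LinearOrder J]
    [WellFoundedLT J] (hJ : #J ≤ μ) :
    ∃ (n : J → ℕ) (c d : ∀ i, Fin (n i) → M), ∀ i,
      SameQF L (tupleOver (⋃ j : Set.Iio i, Set.range (c j) ∪ Set.range (d j)) (c i))
        (tupleOver (⋃ j : Set.Iio i, Set.range (c j) ∪ Set.range (d j)) (d i)) ∧
      ¬ SameQF L (Sum.elim (c i) fun _ : Unit => x) (Sum.elim (d i) fun _ : Unit => x) := by
  let base (i : J) (s : Set.Iio i → Σ n : ℕ, (Fin n → M) × (Fin n → M)) : Set M :=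
    ⋃ j, Set.range (s j).2.1 ∪ Set.range (s j).2.2
  let G (i : J) (s : Set.Iio i → Σ n : ℕ, (Fin n → M) × (Fin n → M))
      (q : Σ n : ℕ, (Fin n → M) × (Fin n → M)) : Prop :=
    (∀ k, q.2.1 k ∈ A) ∧ (∀ k, q.2.2 k ∈ A) ∧
      SameQF L (tupleOver (base i s) q.2.1) (tupleOver (base i s) q.2.2) ∧
      ¬ SameQF L (Sum.elim q.2.1 fun _ : Unit => x) (Sum.elim q.2.2 fun _ : Unit => x)
  obtain ⟨s, hs⟩ := exists_forall_of_wellFoundedLT G fun i s hs => by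
    have hsub : base i s ⊆ A := by
      refine Set.iUnion_subset fun j => Set.union_subset ?_ ?_
      · rintro _ ⟨k, rfl⟩
        exact (hs j).1 k
      · rintro _ ⟨k, rfl⟩
        exact (hs j).2.1 k
    have hcard : #(base i s) ≤ μ := by
      refine (Cardinal.mk_iUnion_le _).trans (Cardinal.mul_le_of_le hμ
        ((Cardinal.mk_set_le _).trans hJ) (ciSup_le' fun j => ?_))
      exact ((Set.countable_range _).union (Set.countable_range _)).le_aleph0.trans hμ
    have := hsplit _ hsub hcard
    unfold NonSplitting at this
    push Not at this
    obtain ⟨n, c, d, h₁, h₂, h₃, h₄⟩ := this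
    exact ⟨⟨n, c, d⟩, h₁, h₂, h₃, h₄⟩
  exact ⟨fun i => (s i).1, fun i => (s i).2.1, fun i => (s i).2.2, fun i => (hs i).2.2⟩

/-- Given splittings `c i`, `d i`, a binary tree of embeddings into a homogeneous extension which
identify, along the two sides of each node, the image of `c i` with the image of `d i`. -/
theorem QFHomogeneous.exists_tree {L : FirstOrder.Language.{u, u}} {M N : Type u} [L.Structure M]
    [L.Structure N] {μ : Cardinal.{u}} (hμ : ℵ₀ ≤ μ) (hN : QFHomogeneous L μ M N)
    (hne : Nonempty (M ↪[L] N)) {J : Type u} [LinearOrder J] [WellFoundedLT J] (hJ : #J ≤ μ)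
    (n : J → ℕ) (c d : ∀ i, Fin (n i) → M)
    (h : ∀ i, SameQF L (tupleOver (⋃ j : Set.Iio i, Set.range (c j) ∪ Set.range (d j)) (c i))
      (tupleOver (⋃ j : Set.Iio i, Set.range (c j) ∪ Set.range (d j)) (d i))) :
    ∃ E : J → (J → Bool) → M ↪[L] N,
      (∀ i η j, j < i → ∀ m ∈ Set.range (c j) ∪ Set.range (d j), E i η m = E j η m) ∧
      (∀ i η η', (∀ j ≤ i, η j = η' j) → E i η = E i η') ∧
      ∀ i η η', (∀ j < i, η j = η' j) → η i = false → η' i = true →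
        ∀ k, E i η (c i k) = E i η' (d i k) := by
  classical
  let S (i : J) : Set M := Set.range (c i) ∪ Set.range (d i)
  have hS (i : J) : #(S i) ≤ μ :=
    ((Set.countable_range _).union (Set.countable_range _)).le_aleph0.trans hμ
  -- The first component is chosen before the bit at `i` is read, the second after it; for the bit
  -- `true`, the second sends `d i` to where the first sends `c i`.
  let Q := (J → Bool) → (M ↪[L] N) × (M ↪[L] N)
  let P₀ (i : J) (s : Set.Iio i → Q) (η : J → Bool) (E : M ↪[L] N) : Prop :=
    ∀ (j : Set.Iio i), ∀ m ∈ S j, E m = (s j η).2 m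
  let G (i : J) (s : Set.Iio i → Q) (q : Q) : Prop :=
    (∀ η, P₀ i s η (q η).2) ∧ (∀ η, η i = false → (q η).2 = (q η).1) ∧
    (∀ η, η i = true → ∀ k, (q η).2 (d i k) = (q η).1 (c i k)) ∧
    (∀ η η', (∀ j < i, η j = η' j) → (q η).1 = (q η').1) ∧
    (∀ η η', (∀ j ≤ i, η j = η' j) → q η = q η')
  obtain ⟨s, hs⟩ := exists_forall_of_wellFoundedLT G fun i s hs => by
    let w : (Σ j : Set.Iio i, S j) → M := fun p => p.2
    let v (η : J → Bool) : (Σ j : Set.Iio i, S j) → N := fun p => (s p.1 η).2 p.2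
    have hcard : #(Σ j : Set.Iio i, S j) ≤ μ := by
      rw [Cardinal.mk_sigma]
      refine (Cardinal.sum_le_mk_mul_iSup _).trans (Cardinal.mul_le_of_le hμ
        ((Cardinal.mk_set_le _).trans hJ) (ciSup_le' fun j => hS j))
    have hvw (η : J → Bool) : SameQF L (v η) w :=
      SameQF.of_coherent hne (fun j : Set.Iio i => S j) (fun j => (s j η).2)
        fun j k hjk m hm => (hs k).1 η ⟨j, hjk⟩ m hm
    have hext₀ (η : J → Bool) : ∃ E, P₀ i s η E := by
      obtain ⟨E, hE⟩ := hN _ (v η) w hcard (hvw η)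
      exact ⟨E, fun j m hm => hE ⟨j, m, hm⟩⟩
    have hext₁ (η : J → Bool) (E₀ : M ↪[L] N) (hE₀ : P₀ i s η E₀) :
        ∃ E, P₀ i s η E ∧ ∀ k, E (d i k) = E₀ (c i k) := by
      have h₁ : SameQF L (Sum.elim w (c i)) (Sum.elim w (d i)) :=
        (h i).of_tupleOver w fun p => Set.mem_iUnion.2 ⟨p.1, p.2.2⟩
      have h₂ : E₀ ∘ Sum.elim w (c i) = Sum.elim (v η) (E₀ ∘ c i) := by
        funext p
        rcases p with p | p
        · exact hE₀ p.1 p.2 p.2.2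
        · rfl
      have h₃ := (SameQF.embedding E₀ (Sum.elim w (c i))).symm.trans h₁
      rw [h₂] at h₃
      obtain ⟨E, hE⟩ := hN _ _ _ (by
        rw [Cardinal.mk_sum]
        simpa using Cardinal.add_le_of_le hμ hcard
          ((Cardinal.natCast_lt_aleph0 (n := n i)).le.trans hμ)) h₃
      exact ⟨E, fun j m hm => hE (.inl ⟨j, m, hm⟩), fun k => hE (.inr k)⟩
    have : Nonempty (M ↪[L] N) := hne
    -- Choosing from the predicate itself makes the choice depend only on `η` below `i`, since
    -- branches agreeing there give equal predicates.
    let E₀ (η : J → Bool) : M ↪[L] N := Classical.epsilon (P₀ i s η)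
    have hE₀ (η : J → Bool) : P₀ i s η (E₀ η) := Classical.epsilon_spec (hext₀ η)
    let E₁ (η : J → Bool) : M ↪[L] N :=
      Classical.epsilon fun E => P₀ i s η E ∧ ∀ k, E (d i k) = E₀ η (c i k)
    have hE₁ (η : J → Bool) : P₀ i s η (E₁ η) ∧ ∀ k, E₁ η (d i k) = E₀ η (c i k) :=
      Classical.epsilon_spec (hext₁ η (E₀ η) (hE₀ η))
    have hP (η η' : J → Bool) (hη : ∀ j < i, η j = η' j) : P₀ i s η = P₀ i s η' := by
      have hs' (j : Set.Iio i) : s j η = s j η' :=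
        (hs j).2.2.2.2 η η' fun k hk => hη k (hk.trans_lt j.2)
      funext E
      simp only [P₀, hs']
    have hE₀' (η η' : J → Bool) (hη : ∀ j < i, η j = η' j) : E₀ η = E₀ η' := by
      simp only [E₀, hP η η' hη]
    refine ⟨fun η => (E₀ η, if η i then E₁ η else E₀ η), fun η => ?_, fun η hη => ?_,
      fun η hη k => ?_, hE₀', fun η η' hη => ?_⟩
    · dsimp only
      split_ifs
      · exact (hE₁ η).1
      · exact hE₀ η
    · simp [hη]
    · simpa [hη] using (hE₁ η).2 k
    · have h₁ := hE₀' η η' fun j hj => hη j hj.le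
      have h₂ : E₁ η = E₁ η' := by
        simp only [E₁, h₁, hP η η' fun j hj => hη j hj.le]
      simp only [h₁, h₂, hη i le_rfl]
  refine ⟨fun i η => (s i η).2, fun i η j hj m hm => (hs i).1 η ⟨j, hj⟩ m hm,
    fun i η η' hη => congrArg Prod.snd ((hs i).2.2.2.2 η η' hη), fun i η η' hη h₀ h₁ k => ?_⟩
  change (s i η).2 (c i k) = (s i η').2 (d i k)
  rw [(hs i).2.1 η h₀, (hs i).2.2.1 η' h₁ k, (hs i).2.2.2.1 η η' hη]

namespace AEC

variable {L : FirstOrder.Language.{u, u}} {K : AEC L}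

/-- Stability in `μ` implies that every type does not split over some set of size at most `μ`. -/
theorem StableIn.exists_nonSplitting (hK : K.SetAP) {μ : Cardinal.{u}} (hμ : ℵ₀ ≤ μ)
    (hs : K.StableIn μ) {M : Type u} [L.Structure M] (hM : K.Mem M) (A : Set M) (x : M) :
    ∃ B ⊆ A, #B ≤ μ ∧ NonSplitting L A B x := by
  classical
  by_contra! hsplit
  obtain ⟨χ, hχ, hχμ, hμχ, hleast⟩ := Cardinal.exists_least_two_power hμ
  let J : Type u := χ.ord.ToType
  have hJ : #J = χ := Cardinal.mk_ord_toType χ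
  have hIic (i : J) : #(Set.Iic i) < χ := by
    have := Cardinal.mk_Iio_lt i (by rw [hJ]; exact (Ordinal.type_toType _).symm)
    rw [← Set.Iio_insert]
    exact Cardinal.mk_insert_le.trans_lt
      (Cardinal.add_lt_of_lt hχ (this.trans_eq hJ) (Cardinal.one_lt_aleph0.trans_le hχ))
  obtain ⟨n, c, d, hcd⟩ := exists_splitting_family hμ hsplit (J := J) (hJ.trans_le hχμ)
  obtain ⟨N, _, hN, hne, hhom⟩ := hK.exists_qfHomogeneous hM hμ
  obtain ⟨E, hEcoh, hEdep, hEeq⟩ := hhom.exists_tree hμ hne (hJ.trans_le hχμ) n c d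
    fun i => (hcd i).1
  let S (i : J) : Set M := Set.range (c i) ∪ Set.range (d i)
  have hS (i : J) : #(S i) ≤ μ :=
    ((Set.countable_range _).union (Set.countable_range _)).le_aleph0.trans hμ
  have hlim (η : J → Bool) : ∃ f : M ↪[L] N, ∀ i, ∀ m ∈ S i, f m = E i η m := by
    obtain ⟨f, hf⟩ := hhom _ _ _ (by
      rw [Cardinal.mk_sigma]
      exact (Cardinal.sum_le_mk_mul_iSup _).trans (Cardinal.mul_le_of_le hμ
        (hJ.trans_le hχμ) (ciSup_le' fun j => hS j)))
      (SameQF.of_coherent hne S (fun i => E i η) fun i j hij m hm => hEcoh j η i hij m hm)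
    exact ⟨f, fun i m hm => hf ⟨i, m, hm⟩⟩
  choose f hf using hlim
  -- The padding value is harmless: `E i` ignores coordinates above `i`. Minimality of `χ` leaves at
  -- most `μ` such segments at each level, so `D` is small.
  let ext (i : J) (g : Set.Iic i → Bool) : J → Bool := fun j => if h : j ≤ i then g ⟨j, h⟩ else false
  let D : Set N := Set.range fun p : Σ i : J, (Set.Iic i → Bool) × S i =>
    E p.1 (ext p.1 p.2.1) p.2.2
  have hD : #D ≤ μ := by
    refine Cardinal.mk_range_le.trans ?_
    rw [Cardinal.mk_sigma]
    refine (Cardinal.sum_le_mk_mul_iSup _).trans (Cardinal.mul_le_of_le hμ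
      (hJ.trans_le hχμ) (ciSup_le' fun i => ?_))
    rw [Cardinal.mk_prod, Cardinal.lift_id, Cardinal.lift_id]
    refine Cardinal.mul_le_of_le hμ ?_ (hS i)
    simpa using hleast _ (hIic i)
  have hmemD (i : J) (η : J → Bool) (m : M) (hm : m ∈ S i) : E i η m ∈ D := by
    refine ⟨⟨i, fun j => η j, m, hm⟩, ?_⟩
    exact congrArg (fun e : M ↪[L] N => e m)
      (hEdep i (ext i fun j => η j) η fun j hj => dif_pos hj)
  obtain ⟨R, hR, hrep⟩ := hK.stableIn_iff.1 hs N hN D hD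
  choose r hr hrs using hrep
  -- Where the branches part, `f η` sends `c i` to the tuple of `D` to which `f η'` sends `d i`.
  -- Equal types of the images of `x` over `D` would undo the splitting at `i`.
  have hsep (η η' : J → Bool) (i : J) (hη : ∀ j < i, η j = η' j) (h₀ : η i = false)
      (h₁ : η' i = true) : r (f η x) ≠ r (f η' x) := by
    intro heq
    have hsame : SameQF L (tupleOver D fun _ : Unit => f η x) (tupleOver D fun _ : Unit => f η' x) :=
      (hrs _).trans (heq ▸ (hrs _).symm)
    have hc (k) : f η (c i k) = E i η (c i k) := hf η i _ (Or.inl ⟨k, rfl⟩)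
    have hd (k) : f η' (d i k) = E i η (c i k) :=
      (hf η' i _ (Or.inr ⟨k, rfl⟩)).trans (hEeq i η η' hη h₀ h₁ k).symm
    have hmid := hsame.of_tupleOver (fun k => E i η (c i k))
      fun k => hmemD i η _ (Or.inl ⟨k, rfl⟩)
    refine (hcd i).2 ?_
    have e₁ := SameQF.embedding (f η) (Sum.elim (c i) fun _ : Unit => x)
    have e₂ := SameQF.embedding (f η') (Sum.elim (d i) fun _ : Unit => x)
    have f₁ : (f η ∘ Sum.elim (c i) fun _ : Unit => x) =
        Sum.elim (fun k => E i η (c i k)) fun _ : Unit => f η x := by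
      funext p
      rcases p with p | p <;> simp [hc]
    have f₂ : (f η' ∘ Sum.elim (d i) fun _ : Unit => x) =
        Sum.elim (fun k => E i η (c i k)) fun _ : Unit => f η' x := by
      funext p
      rcases p with p | p <;> simp [hd]
    rw [f₁] at e₁
    rw [f₂] at e₂
    exact (e₁.trans hmid).trans e₂.symm
  have hinj : Function.Injective fun η : J → Bool => (⟨r (f η x), hr _⟩ : R) := by
    intro η η' heq
    have heq' : r (f η x) = r (f η' x) := congrArg Subtype.val heq
    by_contra hne'
    obtain ⟨i, hi, hmin⟩ := WellFounded.has_min (wellFounded_lt (α := J)) {i | η i ≠ η' i}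
      (Function.ne_iff.1 hne')
    have hη : ∀ j < i, η j = η' j := fun j hj => by
      by_contra hj'
      exact hmin j hj' hj
    cases h₀ : η i
    · exact hsep η η' i hη h₀ (by simpa [h₀] using hi.symm) heq'
    · exact hsep η' η i (fun j hj => (hη j hj).symm) (by simpa [h₀] using hi.symm) h₀ heq'.symm
  have := (Cardinal.mk_le_of_injective hinj).trans hR
  have hpow : #(J → Bool) = 2 ^ χ := by simp [hJ]
  exact (hpow ▸ this).not_gt hμχ

end AEC

/-! ### Counting nonsplitting types. -/

/-- Types which do not split over `B` are determined by their restriction to `B` together with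
representatives of all types of finite tuples over `B`. -/
theorem NonSplitting.sameQF {L : FirstOrder.Language} {M : Type*} [L.Structure M] {A B C : Set M} (hC : C ⊆ A)
    (hrep : ∀ (n : ℕ) (a : Fin n → M), (∀ k, a k ∈ A) →
      ∃ c : Fin n → M, (∀ k, c k ∈ C) ∧ SameQF L (tupleOver B a) (tupleOver B c))
    {x y : M} (hx : NonSplitting L A B x) (hy : NonSplitting L A B y)
    (hxy : SameQF L (tupleOver C fun _ : Unit => x) (tupleOver C fun _ : Unit => y)) :
    SameQF L (tupleOver A fun _ : Unit => x) (tupleOver A fun _ : Unit => y) := by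
  classical
  refine SameQF.of_fin fun n a => ?_
  rcases isEmpty_or_nonempty A with hA | hA
  · have h := hxy.comp fun i : Fin n => (Sum.inr () : C ⊕ Unit)
    have ha (i : Fin n) : a i = Sum.inr () := by
      rcases h : a i with b | b
      · exact hA.elim b
      · rfl
    have hz (z : M) : tupleOver A (fun _ : Unit => z) ∘ a =
        tupleOver C (fun _ : Unit => z) ∘ fun i : Fin n => Sum.inr () := by
      funext i
      simp [ha i]
    rw [hz, hz]
    exact h
  -- Positions occupied by the point itself get an arbitrary entry, which `σ` never reads.
  let b : Fin n → A := fun i => Sum.elim id (fun _ => Classical.arbitrary A) (a i)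
  let σ : Fin n → Fin n ⊕ Unit := fun i => Sum.elim (fun _ => .inl i) .inr (a i)
  -- Nonsplitting of `x` passes from `b` to `c`, agreement over `C` exchanges `x` for `y`, and
  -- nonsplitting of `y` returns to `b`.
  obtain ⟨c, hcC, hc⟩ := hrep n (fun i => b i) fun i => (b i).2
  have hcA (k) : c k ∈ A := hC (hcC k)
  have h := ((hx n _ c (fun i => (b i).2) hcA hc).trans (hxy.of_tupleOver c hcC)).trans
    (hy n _ c (fun i => (b i).2) hcA hc).symm
  have hz (z : M) : tupleOver A (fun _ : Unit => z) ∘ a =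
      (Sum.elim (fun i => (b i : M)) fun _ : Unit => z) ∘ σ := by
    funext i
    simp only [Function.comp_apply, σ, b]
    rcases hu : a i with u | u <;> simp [hu]
  rw [hz, hz]
  exact h.comp σ

theorem mainTheorem9 {L : FirstOrder.Language.{u, u}} (K : AEC L)
    (hAP : K.AP) (hJEP : K.JEP) (hNMM : K.NMM) (hSetAP : K.SetAP)
    (μ : Cardinal.{u}) (hμ : Cardinal.aleph0 ≤ μ)
    (hTame : K.Tame μ) (hStable : K.StableIn μ) :
    ∀ l : Cardinal.{u}, Cardinal.aleph0 ≤ l → l ^ μ = l → K.StableIn l := by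
  intro l hl hlμ
  have hμl : μ ≤ l := by
    rw [← hlμ]
    exact (Cardinal.cantor μ).le.trans
      (Cardinal.power_le_power_right ((Cardinal.ofNat_lt_aleph0 (n := 2)).le.trans hl))
  refine hSetAP.stableIn_iff.2 fun M _ hM A hA => ?_
  let T : Type u := {B : Set A // #B ≤ μ}
  have hT : #T ≤ l := by
    refine (Cardinal.mk_bounded_set_le A μ).trans ?_
    rw [← hlμ]
    exact Cardinal.power_le_power_right (max_le (hlμ.symm ▸ hA) (hlμ.symm ▸ hl))
  let img (B : T) : Set M := Subtype.val '' B.1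
  have himg (B : T) : #(img B) ≤ μ := Cardinal.mk_image_le.trans B.2
  have hcodes (B : T) : ∃ C ⊆ A, #C ≤ μ ∧ ∀ (n : ℕ) (a : Fin n → M), (∀ k, a k ∈ A) →
      ∃ c : Fin n → M, (∀ k, c k ∈ C) ∧ SameQF L (tupleOver (img B) a) (tupleOver (img B) c) := by
    choose R hR hrep using fun n => hStable.exists_tuple_representatives hSetAP hμ hM (himg B) n
    choose r hr hrs using hrep
    -- The representatives lie in `M`, perhaps outside `A`; each one attained from `A` is replaced
    -- by a tuple of `A` that it represents.
    let Z (n : ℕ) : Set (Fin n → M) := {t | t ∈ R n ∧ ∃ a : Fin n → M, (∀ k, a k ∈ A) ∧ r n a = t}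
    have hZ (n : ℕ) (t : Z n) : ∃ a : Fin n → M, (∀ k, a k ∈ A) ∧ r n a = t := t.2.2
    choose g hgA hgr using hZ
    refine ⟨⋃ n, ⋃ t : Z n, Set.range (g n t), ?_, ?_, fun n a ha => ?_⟩
    · refine Set.iUnion_subset fun n => Set.iUnion_subset fun t => ?_
      rintro _ ⟨k, rfl⟩
      exact hgA n t k
    · have hn (n : ℕ) : #(⋃ t : Z n, Set.range (g n t)) ≤ μ := by
        refine (Cardinal.mk_iUnion_le _).trans (Cardinal.mul_le_of_le hμ
          ((Cardinal.mk_le_mk_of_subset fun t ht => ht.1).trans (hR n)) (ciSup_le' fun t => ?_))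
        exact (Set.countable_range _).le_aleph0.trans hμ
      have := Cardinal.mk_iUnion_le_lift fun n : ℕ => ⋃ t : Z n, Set.range (g n t)
      rw [Cardinal.lift_uzero] at this
      exact this.trans (Cardinal.mul_le_of_le hμ (by simpa using hμ)
        (ciSup_le' fun n => by simpa using hn n))
    · have hz : r n a ∈ Z n := ⟨hr n a, a, ha, rfl⟩
      refine ⟨g n ⟨_, hz⟩, fun k => Set.mem_iUnion₂.2 ⟨n, ⟨_, hz⟩, k, rfl⟩, ?_⟩
      have h₁ := hrs n a
      have h₂ := hrs n (g n ⟨_, hz⟩)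
      rw [hgr] at h₂
      exact h₁.trans h₂.symm
  choose C hCA hC hCrep using hcodes
  choose R hR hrep using fun B => hSetAP.stableIn_iff.1 hStable M hM (C B) (hC B)
  choose r hr hrs using hrep
  have hloc (x : M) : ∃ B : T, NonSplitting L A (img B) x := by
    obtain ⟨B, hBA, hB, hx⟩ := hStable.exists_nonSplitting hSetAP hμ hM A x
    refine ⟨⟨Subtype.val ⁻¹' B, (Cardinal.mk_preimage_of_injective _ _
      Subtype.val_injective).trans hB⟩, ?_⟩
    simpa [img, Subtype.image_preimage_coe, Set.inter_eq_self_of_subset_right hBA] using hx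
  choose B hB using hloc
  -- The code of a type is its base `B` together with a representative of its restriction to `C B`,
  -- which depends on `B` alone.
  obtain ⟨S, hS, hSrep⟩ := exists_representatives
    (fun x y : M => SameQF L (tupleOver A fun _ : Unit => x) (tupleOver A fun _ : Unit => y))
    (fun x => (⟨B x, r (B x) x, hr _ _⟩ : Σ B : T, R B)) fun x y hxy => by
      have h₁ : B x = B y := congrArg Sigma.fst hxy
      have h₂ : r (B x) x = r (B y) y := congrArg (fun p : Σ B : T, R B => (p.2 : M)) hxy
      rw [← h₁] at h₂
      exact (hB x).sameQF (hCA (B x)) (hCrep (B x)) (h₁ ▸ hB y)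
        ((hrs (B x) x).trans (h₂ ▸ (hrs (B x) y).symm))
  refine ⟨S, hS.trans ?_, hSrep⟩
  rw [Cardinal.mk_sigma]
  exact (Cardinal.sum_le_mk_mul_iSup _).trans
    (Cardinal.mul_le_of_le hl hT (ciSup_le' fun B => (hR B).trans hμl))
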